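/- There is an absolute constant $C>0$ with the following property. Let $P(x,dy)$ be a transition probability on a measurable space $(\mathbb S,\mathcal S)$ with invariant probability measure $m$, and let $P$ also denote the Markov operator $Pf(x)=\int f(y)\,P(x,dy)$ on $L^2(\mathcal S,m)$. Let $\{W_n\}_{n\ge 0}$ be a stationary ergodic Markov chain on a probability space $(\Omega,\mathcal F,\mathbb P)$ with transition probability $P$ and initial distribution $m$, with respect to a filtration $\{\mathcal F_n\}_{n\ge 0}$ (for instance $\mathcal F_n=\sigma(W_0,\dots,W_n)$). Suppose that $P$ is normal, i.e. $PP^*=P^*P$ on $L^2(\mathcal S,m)$. For a real-valued $f\in L^2(\mathcal S,m)$ write $$S_n(f)=\sum_{k=1}^n f(W_k),\qquad U_n(f)=\sum_{k=1}^n P^k f ,$$ and suppose that $\sum_{n\ge 1}\frac{\|U_n(f)\|_2^2}{n^2}<\infty$. Then $\{f(W_n)\}$ admits a martingale approximation $\{M_n\}$: there is a function $M$ on the path space $\mathbb S^{\mathbb N}$, square integrable for the law of $(W_0,W_1,\dots)$, such that, $\theta$ denoting the shift on $\mathbb S^{\mathbb N}$, the process $M_n=\sum_{k=0}^{n-1}(M\circ\theta^k)(W_0,W_1,\dots)$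 is a martingale with respect to $\{\mathcal F_n\}$ and $\|S_n(f)-M_n\|_2=o(\sqrt n)$. Moreover, for every $n\ge 1$, $$\frac1n\,\|S_n(f)-M_n\|_2^2\le C\Big(\frac1n\sum_{k=1}^n\frac{\|U_k(f)\|_2^2}{k}+\sum_{k\ge n+1}\frac{\|U_k(f)\|_2^2}{k^2}\Big).$$ -/

import Mathlib

open MeasureTheory ProbabilityTheory Filter Asymptotics
open scoped ENNReal NNReal

noncomputable section

namespace NormalChain

/-! ### The Markov operator on `L²(m)` -/

section MarkovOperator

variable {S : Type*} [MeasurableSpace S] {𝕜 : Type*} [RCLike 𝕜]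

/-- The action of a transition kernel on functions: `(κ f)(x) = ∫ f(y) κ(x, dy)`. -/
def kernelAct (κ : Kernel S S) (f : S → 𝕜) (x : S) : 𝕜 := ∫ y, f y ∂(κ x)

theorem ae_ae_of_invariant {κ : Kernel S S} {m : Measure S} (hm : κ.Invariant m)
    {p : S → Prop} (hp : ∀ᵐ y ∂m, p y) : ∀ᵐ x ∂m, ∀ᵐ y ∂(κ x), p y := by
  rw [← hm.def] at hp
  exact Measure.ae_ae_of_ae_comp hp

theorem kernelAct_congr {κ : Kernel S S} {m : Measure S} (hm : κ.Invariant m)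
    {f g : S → 𝕜} (hfg : f =ᵐ[m] g) : kernelAct κ f =ᵐ[m] kernelAct κ g := by
  filter_upwards [ae_ae_of_invariant hm hfg] with x hx
  exact integral_congr_ae hx

theorem aestronglyMeasurable_kernelAct {κ : Kernel S S} [IsMarkovKernel κ] {m : Measure S}
    (hm : κ.Invariant m) {f : S → 𝕜} (hf : AEStronglyMeasurable f m) :
    AEStronglyMeasurable (kernelAct κ f) m :=
  ⟨fun x => ∫ y, hf.mk f y ∂(κ x), hf.stronglyMeasurable_mk.integral_kernel,
    kernelAct_congr hm hf.ae_eq_mk⟩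

theorem eLpNorm_kernelAct_le {κ : Kernel S S} [IsMarkovKernel κ] {m : Measure S}
    (hm : κ.Invariant m) {f : S → 𝕜} (hf : AEStronglyMeasurable f m) :
    eLpNorm (kernelAct κ f) 2 m ≤ eLpNorm f 2 m := by
  have h1 : ∀ᵐ x ∂m, ‖kernelAct κ f x‖ₑ ^ (2 : ℝ) ≤ ∫⁻ y, ‖f y‖ₑ ^ (2 : ℝ) ∂(κ x) := by
    filter_upwards [ae_ae_of_invariant hm hf.ae_eq_mk] with x hx
    have hfx : AEStronglyMeasurable f (κ x) :=
      ⟨hf.mk f, hf.stronglyMeasurable_mk, hx⟩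
    have h2 : ‖kernelAct κ f x‖ₑ ≤ eLpNorm f 2 (κ x) :=
      calc ‖kernelAct κ f x‖ₑ ≤ ∫⁻ y, ‖f y‖ₑ ∂(κ x) := enorm_integral_le_lintegral_enorm f
        _ = eLpNorm f 1 (κ x) := eLpNorm_one_eq_lintegral_enorm.symm
        _ ≤ eLpNorm f 2 (κ x) := eLpNorm_le_eLpNorm_of_exponent_le (by norm_num) hfx
    calc ‖kernelAct κ f x‖ₑ ^ (2 : ℝ) ≤ eLpNorm f 2 (κ x) ^ (2 : ℝ) := by gcongr
      _ = ∫⁻ y, ‖f y‖ₑ ^ (2 : ℝ) ∂(κ x) := by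
        rw [eLpNorm_eq_lintegral_rpow_enorm_toReal (by norm_num) (by norm_num),
          ← ENNReal.rpow_mul]
        simp
  have h3 : ∫⁻ x, ∫⁻ y, ‖f y‖ₑ ^ (2 : ℝ) ∂(κ x) ∂m = ∫⁻ y, ‖f y‖ₑ ^ (2 : ℝ) ∂m := by
    have := Measure.lintegral_bind (m := m) (μ := κ) (f := fun y => ‖f y‖ₑ ^ (2 : ℝ))
      κ.aemeasurable (by rw [hm.def]; exact hf.enorm.pow_const _)
    rw [hm.def] at this
    exact this.symm
  rw [eLpNorm_eq_lintegral_rpow_enorm_toReal (by norm_num) (by norm_num),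
    eLpNorm_eq_lintegral_rpow_enorm_toReal (by norm_num) (by norm_num)]
  refine ENNReal.rpow_le_rpow ?_ (by positivity)
  exact (lintegral_mono_ae h1).trans h3.le

theorem memLp_kernelAct {κ : Kernel S S} [IsMarkovKernel κ] {m : Measure S}
    (hm : κ.Invariant m) {f : S → 𝕜} (hf : MemLp f 2 m) : MemLp (kernelAct κ f) 2 m :=
  ⟨aestronglyMeasurable_kernelAct hm hf.1, (eLpNorm_kernelAct_le hm hf.1).trans_lt hf.2⟩

theorem ae_integrable_of_memLp {κ : Kernel S S} [IsMarkovKernel κ] {m : Measure S}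
    [IsFiniteMeasure m] (hm : κ.Invariant m) {f : S → 𝕜} (hf : MemLp f 2 m) :
    ∀ᵐ x ∂m, Integrable f (κ x) := by
  have hi : Integrable f (m.bind κ) := by
    rw [hm.def]; exact hf.integrable (by norm_num)
  exact ((Measure.integrable_comp_iff hi.1).1 hi).1

variable (𝕜) in
/-- The Markov operator `P` on `L²(m)` of a transition kernel `κ` with invariant probability
measure `m`: `(P f)(x) = ∫ f(y) κ(x, dy)` for `m`-almost every `x`. -/
def markovOp (κ : Kernel S S) [IsMarkovKernel κ] (m : Measure S) [IsProbabilityMeasure m]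
    (hm : κ.Invariant m) : Lp 𝕜 2 m →L[𝕜] Lp 𝕜 2 m :=
  LinearMap.mkContinuous
    { toFun := fun f => (memLp_kernelAct hm (Lp.memLp f)).toLp (kernelAct κ f)
      map_add' := fun f g => by
        rw [← MemLp.toLp_add, MemLp.toLp_eq_toLp_iff]
        refine (kernelAct_congr hm (Lp.coeFn_add f g)).trans ?_
        filter_upwards [ae_integrable_of_memLp hm (Lp.memLp f),
          ae_integrable_of_memLp hm (Lp.memLp g)] with x hf hg
        exact integral_add hf hg
      map_smul' := fun c f => by
        rw [RingHom.id_apply, ← MemLp.toLp_const_smul, MemLp.toLp_eq_toLp_iff]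
        refine (kernelAct_congr hm (Lp.coeFn_smul c f)).trans ?_
        filter_upwards with x
        exact integral_smul c f }
    1 fun f => by
      rw [one_mul]
      refine (Lp.norm_toLp _ (memLp_kernelAct hm (Lp.memLp f))).trans_le ?_
      exact ENNReal.toReal_mono (Lp.memLp f).2.ne (eLpNorm_kernelAct_le hm (Lp.memLp f).1)

theorem coeFn_markovOp (κ : Kernel S S) [IsMarkovKernel κ] (m : Measure S)
    [IsProbabilityMeasure m] (hm : κ.Invariant m) (f : Lp 𝕜 2 m) :
    markovOp 𝕜 κ m hm f =ᵐ[m] fun x => ∫ y, f y ∂(κ x) :=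
  MemLp.coeFn_toLp (memLp_kernelAct hm (Lp.memLp f))

/-- `U_n(f) = ∑_{k=1}^n P^k f`, an element of `L²(m)`. -/
def markovSum (κ : Kernel S S) [IsMarkovKernel κ] (m : Measure S) [IsProbabilityMeasure m]
    (hm : κ.Invariant m) (f : Lp 𝕜 2 m) (n : ℕ) : Lp 𝕜 2 m :=
  ∑ k ∈ Finset.Icc 1 n, (markovOp 𝕜 κ m hm ^ k) f

end MarkovOperator

/-! ### Markov chains, the path space and its shift -/

section Chain

variable {S Ω : Type*} [MeasurableSpace S] {mΩ : MeasurableSpace Ω}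

/-- `W` is a Markov chain with respect to the filtration `ℱ` under the measure `μ`, with
transition probability `κ` and initial distribution `m`. -/
structure IsMarkovChain (κ : Kernel S S) (m : Measure S) (ℱ : Filtration ℕ mΩ)
    (μ : Measure Ω) (W : ℕ → Ω → S) : Prop where
  adapted : ∀ n, Measurable[ℱ n] (W n)
  initial : μ.map (W 0) = m
  markov : ∀ (n : ℕ) (A : Set S), MeasurableSet A →
    μ[(W (n + 1) ⁻¹' A).indicator (fun _ => (1 : ℝ)) | ℱ n] =ᵐ[μ] fun ω => (κ (W n ω)).real A

/-- The trajectory `(W_0(ω), W_1(ω), …)`, a point of the path space `S^ℕ`. -/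
def path (W : ℕ → Ω → S) (ω : Ω) : ℕ → S := fun n => W n ω

/-- The shift `θ` on the path space `S^ℕ`. -/
def shift (x : ℕ → S) : ℕ → S := fun n => x (n + 1)

/-- The chain `W` is stationary and ergodic: the shift preserves the law of the trajectory on
the path space `S^ℕ` and is ergodic for it. -/
def IsStationaryErgodic (μ : Measure Ω) (W : ℕ → Ω → S) : Prop :=
  Ergodic (shift : (ℕ → S) → ℕ → S) (μ.map (path W))

/-- `S_n(f) = ∑_{k=1}^n f(W_k)`. -/
def partialSum (W : ℕ → Ω → S) (f : S → ℝ) (n : ℕ) (ω : Ω) : ℝ :=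
  ∑ k ∈ Finset.Icc 1 n, f (W k ω)

/-- `M_n = ∑_{k=0}^{n-1} M ∘ θ^k`, evaluated along the trajectory of `W`, for a function `M`
on the path space. -/
def stationarySum (W : ℕ → Ω → S) (M : (ℕ → S) → ℝ) (n : ℕ) (ω : Ω) : ℝ :=
  ∑ k ∈ Finset.range n, M (shift^[k] (path W ω))

/-- The function `M` on the path space gives a martingale approximation
`M_n = ∑_{k=0}^{n-1} M ∘ θ^k` of the process `f(W_n)`: `M` is square integrable, `M_n` is a
martingale for `ℱ`, and `‖S_n(f) - M_n‖₂ = o(√n)`. -/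
structure IsMartingaleApproximation (ℱ : Filtration ℕ mΩ) (μ : Measure Ω) (W : ℕ → Ω → S)
    (f : S → ℝ) (M : (ℕ → S) → ℝ) : Prop where
  memLp : MemLp M 2 (μ.map (path W))
  martingale : Martingale (stationarySum W M) ℱ μ
  remainder : (fun n : ℕ => (eLpNorm (partialSum W f n - stationarySum W M n) 2 μ).toReal)
    =o[atTop] fun n : ℕ => √(n : ℝ)

end Chain

end NormalChain

end

/-!
Write `U_n = ∑_{k=1}^n P^k f` and let `h_n = f + n⁻¹ ∑_{j<n} U_j` be the Cesàro approximation to the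
solution of the Poisson equation. Then `h_n - P h_n = f - U_n / n`, while `P h_n` is the mean of
`U_1, …, U_n`. With `D h (x, y) = h(y) - (P h)(x)`, the martingale with increments
`(D h_n)(W_k, W_{k+1})` therefore differs from `S_n(f)` by two boundary terms `P h_n` and a sum of
`n` copies of `U_n / n`. All of these are controlled by the quadratic mean of
`‖U_1‖, …, ‖U_n‖`, since `U_n = U_j + P^j U_{n-j}` bounds `‖U_n‖` by it (`norm_orbitSum_le`).

It remains to show that `D h_n` converges in `L²` of the law of two consecutive states, at the right
speed. There `‖D x‖² = B(x, x)` for the form `B(x, y) = ⟪x, y⟫ - ⟪P x, P y⟫`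
(`norm_martingaleDiff_sq`). Normality gives `B(x, y) ≤ 2 ‖x‖ ‖y - P y‖` (`defectForm_le`), because
`1 - P†P = (1 - P†) + P†(1 - P)` and `‖(1 - P†) y‖ = ‖(1 - P) y‖`. This replaces the spectral theorem.
In the expansion of `B(h_N - h_a, h_N - h_a)` around `h_n - h_a`, with `n ≤ N ≤ 2n`, the cross term
pairs a vector bounded by the quadratic means with `(1 - P)(h_N - h_n) = U_n / n - U_N / N`, so it
costs only a multiple of `e(n) + e(N) + (a / n) e(a)`, where `e(n) = n⁻² ∑_{k ≤ n} ‖U_k‖²`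
(`defectForm_step`). Along `n = a, 2a, 4a, …` the last term sums geometrically, and the others
telescope: `e(n) ≤ 2 (R(n) - R(2n))`, where `R(n) = ∑_k ‖U_k‖² / (k max(k, n))` is the bracket on
the right-hand side of the theorem (`avgRate_le_tailRate_sub`, `defectForm_pow_two_le`).

The limit `G` of `D h_n` along powers of two defines the martingale, with `M(x) = G(x_0, x_1)`: the
functions `G` for which `G(W_k, W_{k+1})` is centred on every event of the past of `k` form a closed
subspace containing the range of `D` (`martingaleDiff_mem_centredSteps`), and on this subspace the
increments are orthogonal (`norm_sum_evalStep_sq`). Finally `R(n) → 0` by dominated convergence, so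
the quantitative bound contains the estimate `o(√n)`.
-/

noncomputable section

namespace NormalChain

/-! ### The rate of approximation as a functional of a real sequence -/

section Rate

/-- The averaged quantity `n⁻² ∑_{k=1}^n b_k`. -/
def avgRate (b : ℕ → ℝ) (n : ℕ) : ℝ := (∑ k ∈ Finset.range n, b (k + 1)) / (n : ℝ) ^ 2

/-- The rate `∑_k b_k / (k max(k, n))`, which is
`n⁻¹ ∑_{k ≤ n} b_k / k + ∑_{k > n} b_k / k²` written as a single series.
The term `k = 0` is `0` since it is a division by `0`. -/
def tailRate (b : ℕ → ℝ) (n : ℕ) : ℝ := ∑' k : ℕ, b k / ((k : ℝ) * max (k : ℝ) n)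

variable {b : ℕ → ℝ}

theorem avgRate_nonneg (hb : ∀ k, 0 ≤ b k) (n : ℕ) : 0 ≤ avgRate b n :=
  div_nonneg (Finset.sum_nonneg fun k _ => hb _) (by positivity)

theorem tailRate_term_nonneg (hb : ∀ k, 0 ≤ b k) (n k : ℕ) :
    0 ≤ b k / ((k : ℝ) * max (k : ℝ) n) :=
  div_nonneg (hb k) (by positivity)

theorem tailRate_nonneg (hb : ∀ k, 0 ≤ b k) (n : ℕ) : 0 ≤ tailRate b n :=
  tsum_nonneg fun k => tailRate_term_nonneg hb n k

theorem tailRate_term_anti (hb : ∀ k, 0 ≤ b k) {n N : ℕ} (h : n ≤ N) (k : ℕ) :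
    b k / ((k : ℝ) * max (k : ℝ) N) ≤ b k / ((k : ℝ) * max (k : ℝ) n) := by
  rcases Nat.eq_zero_or_pos k with rfl | hk
  · simp
  · have hk' : (0 : ℝ) < k := by exact_mod_cast hk
    have : (n : ℝ) ≤ N := by exact_mod_cast h
    have := hb k
    gcongr

theorem tailRate_term_le (hb : ∀ k, 0 ≤ b k) (n k : ℕ) :
    b k / ((k : ℝ) * max (k : ℝ) n) ≤ b k / (k : ℝ) ^ 2 := by
  simpa [pow_two] using tailRate_term_anti hb (Nat.zero_le n) k

theorem summable_tailRate (hb : ∀ k, 0 ≤ b k) (hs : Summable fun k : ℕ => b k / (k : ℝ) ^ 2)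
    (n : ℕ) : Summable fun k : ℕ => b k / ((k : ℝ) * max (k : ℝ) n) :=
  Summable.of_nonneg_of_le (tailRate_term_nonneg hb n) (tailRate_term_le hb n) hs

theorem tailRate_antitone (hb : ∀ k, 0 ≤ b k) (hs : Summable fun k : ℕ => b k / (k : ℝ) ^ 2) :
    Antitone (tailRate b) := fun _ _ h =>
  (summable_tailRate hb hs _).tsum_le_tsum (tailRate_term_anti hb h) (summable_tailRate hb hs _)

theorem tendsto_tailRate (hb : ∀ k, 0 ≤ b k) (hs : Summable fun k : ℕ => b k / (k : ℝ) ^ 2) :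
    Tendsto (tailRate b) atTop (nhds 0) := by
  have := tendsto_tsum_of_dominated_convergence (𝓕 := atTop)
    (f := fun (n k : ℕ) => b k / ((k : ℝ) * max (k : ℝ) n)) (g := fun _ => 0) hs
    (fun k => by
      rcases Nat.eq_zero_or_pos k with rfl | hk
      · simp
      · have hk' : (0 : ℝ) < k := by exact_mod_cast hk
        refine tendsto_const_nhds.div_atTop (Tendsto.const_mul_atTop hk' ?_)
        exact tendsto_atTop_mono (fun n => le_max_right _ _) tendsto_natCast_atTop_atTop)
    (Eventually.of_forall fun n k => by
      rw [Real.norm_of_nonneg (tailRate_term_nonneg hb n k)]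
      exact tailRate_term_le hb n k)
  rw [tsum_zero] at this
  exact this

/-- The averaged quantity is controlled by the decrease of the rate from `n` to `2n`, so that its
sum along `n, 2n, 4n, …` telescopes. -/
theorem avgRate_le_tailRate_sub (hb : ∀ k, 0 ≤ b k)
    (hs : Summable fun k : ℕ => b k / (k : ℝ) ^ 2) {n : ℕ} (hn : 1 ≤ n) :
    avgRate b n ≤ 2 * (tailRate b n - tailRate b (2 * n)) := by
  have hn' : (0 : ℝ) < n := by exact_mod_cast hn
  have h1 := summable_tailRate hb hs n
  have h2 := summable_tailRate hb hs (2 * n)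
  rw [tailRate, tailRate, ← h1.tsum_sub h2, avgRate, Finset.sum_div]
  have h3 : ∑ k ∈ Finset.range n, b (k + 1) / (n : ℝ) ^ 2
      = ∑ k ∈ Finset.Ico 1 (n + 1), b k / (n : ℝ) ^ 2 := by
    rw [Finset.sum_Ico_eq_sum_range]
    simp [add_comm]
  rw [h3]
  have h4 := (h1.sub h2).sum_le_tsum (Finset.Ico 1 (n + 1)) (fun k _ =>
    sub_nonneg.2 (tailRate_term_anti hb (by omega) k))
  refine le_trans ?_ (mul_le_mul_of_nonneg_left h4 (by norm_num))
  rw [Finset.mul_sum]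
  refine Finset.sum_le_sum fun k hk => ?_
  rw [Finset.mem_Ico] at hk
  have hk1 : (0 : ℝ) < k := by exact_mod_cast hk.1
  have hk2 : (k : ℝ) ≤ n := by exact_mod_cast Nat.lt_succ_iff.1 hk.2
  have e1 : max (k : ℝ) n = n := max_eq_right hk2
  have e2 : max (k : ℝ) ((2 * n : ℕ) : ℝ) = 2 * n := by
    push_cast; exact max_eq_right (by linarith)
  rw [e1, e2]
  have e3 : 2 * (b k / (k * (n : ℝ)) - b k / (k * (2 * (n : ℝ)))) = b k / (k * n) := by
    field_simp; ring
  rw [e3]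
  have := hb k
  rw [pow_two]
  gcongr

theorem avgRate_le_tailRate (hb : ∀ k, 0 ≤ b k)
    (hs : Summable fun k : ℕ => b k / (k : ℝ) ^ 2) {n : ℕ} (hn : 1 ≤ n) :
    avgRate b n ≤ 2 * tailRate b n := by
  have h1 := avgRate_le_tailRate_sub hb hs hn
  have h2 := tailRate_nonneg hb (2 * n)
  linarith

theorem tailRate_eq (hb : ∀ k, 0 ≤ b k) (hs : Summable fun k : ℕ => b k / (k : ℝ) ^ 2) (n : ℕ) :
    tailRate b n = 1 / (n : ℝ) * ∑ k ∈ Finset.Icc 1 n, b k / (k : ℝ)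
      + ∑' k : ℕ, b (n + 1 + k) / ((n + 1 + k : ℕ) : ℝ) ^ 2 := by
  rw [tailRate, ← (summable_tailRate hb hs n).sum_add_tsum_nat_add (n + 1)]
  congr 1
  · rw [Finset.range_eq_Ico, Finset.sum_eq_sum_Ico_succ_bot (by omega), Finset.mul_sum]
    simp only [CharP.cast_eq_zero, zero_mul, div_zero, zero_add]
    refine Finset.sum_congr (by ext; simp) fun k hk => ?_
    rw [Finset.mem_Icc] at hk
    rw [max_eq_right (by exact_mod_cast hk.2), div_mul_div_comm, one_mul, mul_comm (n : ℝ)]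
  · refine tsum_congr fun k => ?_
    rw [add_comm k, max_eq_left (by exact_mod_cast (by omega : n ≤ n + 1 + k)), pow_two]

end Rate

/-! ### Normal contractions of a Hilbert space -/

section Hilbert

variable {H : Type*} [NormedAddCommGroup H] [InnerProductSpace ℝ H]

/-- The orbit sum `U_n = ∑_{k=1}^n T^k f`. -/
def orbitSum (T : H →L[ℝ] H) (f : H) (n : ℕ) : H := ∑ k ∈ Finset.Icc 1 n, (T ^ k) f

/-- The approximate solution `h_n = ∑_{k=0}^{n-1} (1 - k/n) T^k f` of the Poisson equation
`h - T h = f`, written as `f + n⁻¹ ∑_{j<n} U_j`. -/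
def poissonApprox (T : H →L[ℝ] H) (f : H) (n : ℕ) : H :=
  f + (n : ℝ)⁻¹ • ∑ j ∈ Finset.range n, orbitSum T f j

/-- The form `⟪x, y⟫ - ⟪T x, T y⟫`, which is positive when `T` is a contraction. -/
def defectForm (T : H →L[ℝ] H) (x y : H) : ℝ := inner ℝ x y - inner ℝ (T x) (T y)

variable (T : H →L[ℝ] H) (f : H)

theorem orbitSum_zero : orbitSum T f 0 = 0 := by simp [orbitSum]

theorem orbitSum_succ (n : ℕ) : orbitSum T f (n + 1) = orbitSum T f n + (T ^ (n + 1)) f := by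
  rw [orbitSum, Finset.sum_Icc_succ_top (by omega), orbitSum]

theorem map_orbitSum (n : ℕ) : T (orbitSum T f n) = orbitSum T f (n + 1) - T f := by
  induction n with
  | zero => simp [orbitSum]
  | succ n ih =>
    rw [orbitSum_succ, map_add, ih, orbitSum_succ T f (n + 1), pow_succ' T (n + 1)]
    simp only [mul_apply_eq_comp]
    abel

theorem orbitSum_add (j k : ℕ) :
    orbitSum T f (j + k) = orbitSum T f j + (T ^ j) (orbitSum T f k) := by
  induction k with
  | zero => simp [orbitSum_zero]
  | succ k ih =>
    rw [← add_assoc, orbitSum_succ, ih, orbitSum_succ, map_add, add_assoc, add_assoc j, pow_add T j]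
    rfl

theorem map_poissonApprox {n : ℕ} (hn : 1 ≤ n) :
    T (poissonApprox T f n) = (n : ℝ)⁻¹ • ∑ j ∈ Finset.range n, orbitSum T f (j + 1) := by
  have hn' : (n : ℝ) ≠ 0 := by positivity
  rw [poissonApprox, map_add, map_smul, map_sum]
  simp only [map_orbitSum, Finset.sum_sub_distrib, Finset.sum_const, Finset.card_range, smul_sub]
  rw [← Nat.cast_smul_eq_nsmul ℝ, smul_smul, inv_mul_cancel₀ hn', one_smul]
  abel

theorem poissonApprox_sub_map {n : ℕ} (hn : 1 ≤ n) :
    poissonApprox T f n - T (poissonApprox T f n) = f - (n : ℝ)⁻¹ • orbitSum T f n := by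
  have h := Finset.sum_range_sub (orbitSum T f) n
  rw [orbitSum_zero, sub_zero, Finset.sum_sub_distrib] at h
  rw [map_poissonApprox T f hn, poissonApprox, ← h, smul_sub]
  abel

/-- The squared norms of the orbit sums. -/
def orbitSq (k : ℕ) : ℝ := ‖orbitSum T f k‖ ^ 2

theorem orbitSq_nonneg (k : ℕ) : 0 ≤ orbitSq T f k := sq_nonneg _

/-- The root mean square `√(n⁻¹ ∑_{k=1}^n ‖U_k‖²)`. -/
def orbitRms (n : ℕ) : ℝ := √((n : ℝ) * avgRate (orbitSq T f) n)

theorem orbitRms_nonneg (n : ℕ) : 0 ≤ orbitRms T f n := Real.sqrt_nonneg _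

theorem orbitRms_sq (n : ℕ) : orbitRms T f n ^ 2 = n * avgRate (orbitSq T f) n :=
  Real.sq_sqrt (mul_nonneg (by positivity) (avgRate_nonneg (orbitSq_nonneg T f) n))

theorem mul_orbitRms_sq {n : ℕ} (hn : 1 ≤ n) :
    n * orbitRms T f n ^ 2 = ∑ k ∈ Finset.range n, orbitSq T f (k + 1) := by
  have hn' : (n : ℝ) ≠ 0 := by positivity
  rw [orbitRms_sq, avgRate]
  field_simp

/-- Cauchy–Schwarz for the mean of `n` vectors. -/
theorem norm_avg_le_orbitRms {n : ℕ} (hn : 1 ≤ n) {v : ℕ → H}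
    (hv : ∑ j ∈ Finset.range n, ‖v j‖ ^ 2 ≤ ∑ k ∈ Finset.range n, orbitSq T f (k + 1)) :
    ‖(n : ℝ)⁻¹ • ∑ j ∈ Finset.range n, v j‖ ≤ orbitRms T f n := by
  have hn' : (0 : ℝ) < n := by positivity
  rw [norm_smul, norm_inv, Real.norm_natCast, inv_mul_le_iff₀ hn']
  refine (norm_sum_le _ _).trans (abs_le_of_sq_le_sq' ?_ ?_).2
  · refine sq_sum_le_card_mul_sum_sq.trans ?_
    rw [Finset.card_range, mul_pow, pow_two (n : ℝ), mul_assoc, mul_orbitRms_sq T f hn]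
    gcongr
  · exact mul_nonneg hn'.le (orbitRms_nonneg T f n)

theorem norm_map_poissonApprox_le {n : ℕ} (hn : 1 ≤ n) :
    ‖T (poissonApprox T f n)‖ ≤ orbitRms T f n := by
  rw [map_poissonApprox T f hn]
  exact norm_avg_le_orbitRms T f hn le_rfl

theorem norm_poissonApprox_sub_le {n : ℕ} (hn : 1 ≤ n) :
    ‖poissonApprox T f n - f‖ ≤ orbitRms T f n := by
  rw [poissonApprox, add_sub_cancel_left]
  refine norm_avg_le_orbitRms T f hn ?_
  have h := Finset.sum_range_succ' (orbitSq T f) n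
  rw [Finset.sum_range_succ] at h
  have h0 : orbitSq T f 0 = 0 := by simp [orbitSq, orbitSum_zero]
  have := orbitSq_nonneg T f n
  change ∑ j ∈ Finset.range n, orbitSq T f j ≤ _
  linarith

theorem norm_poissonApprox_sub_poissonApprox_le {n a : ℕ} (hn : 1 ≤ n) (ha : 1 ≤ a) :
    ‖poissonApprox T f n - poissonApprox T f a‖ ≤ orbitRms T f n + orbitRms T f a := by
  rw [← sub_sub_sub_cancel_right _ _ f]
  exact (norm_sub_le _ _).trans
    (add_le_add (norm_poissonApprox_sub_le T f hn) (norm_poissonApprox_sub_le T f ha))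

variable {T}

/-- By `U_n = U_j + T^j U_{n-j}`, the last orbit sum is comparable with the average ones. -/
theorem norm_orbitSum_le (hT : ‖T‖ ≤ 1) {n : ℕ} (hn : 1 ≤ n) :
    ‖orbitSum T f n‖ ≤ 2 * orbitRms T f n := by
  have hn' : (0 : ℝ) < n := by positivity
  have h1 : ∀ j ∈ Finset.range n,
      ‖orbitSum T f n‖ ^ 2 ≤ 2 * orbitSq T f (j + 1) + 2 * orbitSq T f (n - 1 - j) := by
    intro j hj
    rw [Finset.mem_range] at hj
    have h2 : ‖orbitSum T f n‖ ≤ ‖orbitSum T f (j + 1)‖ + ‖orbitSum T f (n - 1 - j)‖ := by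
      conv_lhs => rw [show n = (j + 1) + (n - 1 - j) by omega, orbitSum_add]
      refine (norm_add_le _ _).trans (add_le_add le_rfl ?_)
      refine (ContinuousLinearMap.le_opNorm _ _).trans (mul_le_of_le_one_left (norm_nonneg _) ?_)
      exact (norm_pow_le' T (Nat.succ_pos j)).trans (pow_le_one₀ (norm_nonneg _) hT)
    unfold orbitSq
    nlinarith [sq_nonneg (‖orbitSum T f (j + 1)‖ - ‖orbitSum T f (n - 1 - j)‖),
      norm_nonneg (orbitSum T f n)]
  have h3 := Finset.sum_le_sum h1
  rw [Finset.sum_add_distrib, ← Finset.mul_sum, ← Finset.mul_sum,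
    Finset.sum_range_reflect (orbitSq T f) n, Finset.sum_const, Finset.card_range, nsmul_eq_mul,
    ← mul_orbitRms_sq T f hn] at h3
  have h := Finset.sum_range_succ' (orbitSq T f) n
  rw [Finset.sum_range_succ, ← mul_orbitRms_sq T f hn] at h
  have h0 : orbitSq T f 0 = 0 := by simp [orbitSq, orbitSum_zero]
  have := orbitSq_nonneg T f n
  refine (abs_le_of_sq_le_sq' ?_ (mul_nonneg two_pos.le (orbitRms_nonneg T f n))).2
  refine le_of_mul_le_mul_left ?_ hn'
  nlinarith

/-- The only use of normality: `1 - T†T = (1 - T†) + T†(1 - T)`, and `1 - T†` and `1 - T` have the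
same norm at every vector. -/
theorem defectForm_le [CompleteSpace H] (hT : ‖T‖ ≤ 1) (hN : IsStarNormal T) (x y : H) :
    defectForm T x y ≤ 2 * ‖x‖ * ‖y - T y‖ := by
  have h1 : defectForm T x y
      = inner ℝ x ((ContinuousLinearMap.adjoint (1 - T)) y) + inner ℝ (T x) (y - T y) := by
    rw [ContinuousLinearMap.adjoint_inner_right, defectForm]
    simp only [inner_sub_left, inner_sub_right, sub_apply,
      one_apply_eq_self]
    ring
  have h2 : ‖(ContinuousLinearMap.adjoint (1 - T)) y‖ = ‖y - T y‖ :=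
    (ContinuousLinearMap.isStarNormal_iff_norm_eq_adjoint.1 (inferInstance : IsStarNormal (1 - T))
      y).symm
  have h3 := real_inner_le_norm x ((ContinuousLinearMap.adjoint (1 - T)) y)
  have h4 := real_inner_le_norm (T x) (y - T y)
  have h5 : ‖T x‖ ≤ ‖x‖ := by simpa using T.le_of_opNorm_le hT x
  rw [h2] at h3
  have h6 := mul_le_mul_of_nonneg_right h5 (norm_nonneg (y - T y))
  rw [h1]
  linarith

/-- Passing from `h_n` to `h_N` changes the defect of `h_n - h_a` by summable terms: the cross term
pairs `h_n - h_a` with `(1 - T)(h_N - h_n) = U_n / n - U_N / N`. -/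
theorem defectForm_step [CompleteSpace H] (hT : ‖T‖ ≤ 1) (hN : IsStarNormal T) {a n N : ℕ}
    (ha : 1 ≤ a) (han : a ≤ n) (hnN : n ≤ N) (hN2 : N ≤ 2 * n) :
    defectForm T (poissonApprox T f N - poissonApprox T f a)
        (poissonApprox T f N - poissonApprox T f a)
      ≤ defectForm T (poissonApprox T f n - poissonApprox T f a)
          (poissonApprox T f n - poissonApprox T f a)
        + (16 * avgRate (orbitSq T f) n + 32 * avgRate (orbitSq T f) N
          + 4 * (a / n) * avgRate (orbitSq T f) a) := by
  set x := poissonApprox T f n - poissonApprox T f a with hx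
  set y := poissonApprox T f N - poissonApprox T f a with hy
  set g := poissonApprox T f N - poissonApprox T f n with hg
  have hn1 : 1 ≤ n := ha.trans han
  have hN1 : 1 ≤ N := hn1.trans hnN
  have hn0 : (0 : ℝ) < n := by positivity
  have hN0 : (0 : ℝ) < N := by positivity
  have e1 : defectForm T y y = defectForm T x x + defectForm T (x + y) g := by
    have : g = y - x := by rw [hg, hy, hx]; abel
    rw [this]
    simp only [defectForm, inner_add_left, inner_sub_right, map_add, map_sub]
    rw [real_inner_comm x y, real_inner_comm (T x) (T y)]
    ring
  have e2 : g - T g = (n : ℝ)⁻¹ • orbitSum T f n - (N : ℝ)⁻¹ • orbitSum T f N := by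
    have h1 := poissonApprox_sub_map T f hn1
    have h2 := poissonApprox_sub_map T f hN1
    calc g - T g = (poissonApprox T f N - T (poissonApprox T f N))
          - (poissonApprox T f n - T (poissonApprox T f n)) := by rw [hg, map_sub]; abel
      _ = _ := by rw [h1, h2]; abel
  have e3 : ‖g - T g‖ ≤ 2 / n * (orbitRms T f n + orbitRms T f N) := by
    rw [e2]
    refine (norm_sub_le _ _).trans ?_
    rw [norm_smul, norm_smul, norm_inv, norm_inv, Real.norm_natCast, Real.norm_natCast]
    have h1 := norm_orbitSum_le f hT hn1
    have h2 := norm_orbitSum_le f hT hN1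
    have h3 : (N : ℝ)⁻¹ ≤ (n : ℝ)⁻¹ := inv_anti₀ hn0 (by exact_mod_cast hnN)
    calc (n : ℝ)⁻¹ * ‖orbitSum T f n‖ + (N : ℝ)⁻¹ * ‖orbitSum T f N‖
        ≤ (n : ℝ)⁻¹ * (2 * orbitRms T f n) + (n : ℝ)⁻¹ * (2 * orbitRms T f N) := by gcongr
      _ = _ := by ring
  have e4 : ‖x + y‖ ≤ orbitRms T f n + orbitRms T f N + 2 * orbitRms T f a := by
    have h1 := norm_poissonApprox_sub_poissonApprox_le T f hn1 ha
    have h2 := norm_poissonApprox_sub_poissonApprox_le T f hN1 ha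
    have := norm_add_le x y
    linarith
  have e5 := defectForm_le hT hN (x + y) g
  rw [e1]
  refine add_le_add le_rfl (e5.trans ?_)
  have p0 := orbitRms_nonneg T f n
  have p1 := orbitRms_nonneg T f N
  have p2 := orbitRms_nonneg T f a
  have hNn : (N : ℝ) / n ≤ 2 := by
    rw [div_le_iff₀ hn0]; exact_mod_cast hN2
  -- `orbitRms n ^ 2 = n · avgRate n` turns the products into rates; the factor `32` comes from `N ≤ 2n`.
  calc 2 * ‖x + y‖ * ‖g - T g‖
      ≤ 2 * (orbitRms T f n + orbitRms T f N + 2 * orbitRms T f a)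
          * (2 / n * (orbitRms T f n + orbitRms T f N)) := by gcongr
    _ = 4 / n * ((orbitRms T f n + orbitRms T f N + 2 * orbitRms T f a)
          * (orbitRms T f n + orbitRms T f N)) := by ring
    _ ≤ 4 / n * (4 * orbitRms T f n ^ 2 + 4 * orbitRms T f N ^ 2 + orbitRms T f a ^ 2) := by
        gcongr
        nlinarith [sq_nonneg (orbitRms T f n - orbitRms T f N),
          sq_nonneg (orbitRms T f n + orbitRms T f N - orbitRms T f a)]
    _ = 16 * avgRate (orbitSq T f) n + 16 * (N / n) * avgRate (orbitSq T f) N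
          + 4 * (a / n) * avgRate (orbitSq T f) a := by
        rw [orbitRms_sq, orbitRms_sq, orbitRms_sq]
        field_simp
        ring
    _ ≤ _ := by
        have := avgRate_nonneg (orbitSq_nonneg T f) N
        nlinarith

/-- The approximations along `a, 2a, 4a, …` form a Cauchy sequence for the defect form, at the
speed given by `tailRate`. -/
theorem defectForm_pow_two_le [CompleteSpace H] (hT : ‖T‖ ≤ 1) (hN : IsStarNormal T)
    (hs : Summable fun k : ℕ => orbitSq T f k / (k : ℝ) ^ 2) {a : ℕ} (ha : 1 ≤ a) (J : ℕ) :
    defectForm T (poissonApprox T f (2 ^ J * a) - poissonApprox T f a)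
        (poissonApprox T f (2 ^ J * a) - poissonApprox T f a)
      ≤ 112 * tailRate (orbitSq T f) a := by
  have hb := orbitSq_nonneg T f
  set R := tailRate (orbitSq T f) with hR
  set ε := avgRate (orbitSq T f) with hε
  -- Iterating the step along `a, 2a, 4a, …`, the rates telescope and the last terms are geometric.
  have key : defectForm T (poissonApprox T f (2 ^ J * a) - poissonApprox T f a)
        (poissonApprox T f (2 ^ J * a) - poissonApprox T f a)
      ≤ 32 * (R a - R (2 ^ J * a)) + 64 * (R (2 * a) - R (2 ^ (J + 1) * a))
        + 8 * (1 - (2 ^ J : ℝ)⁻¹) * ε a := by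
    induction J with
    | zero => simp [defectForm]
    | succ J ih =>
      have hpos : 1 ≤ 2 ^ J * a := Nat.mul_pos (by positivity) ha
      have hle : a ≤ 2 ^ J * a := Nat.le_mul_of_pos_left a (by positivity)
      have e1 : 2 ^ (J + 1) * a = 2 * (2 ^ J * a) := by ring
      have e2 : 2 ^ (J + 1 + 1) * a = 2 * (2 * (2 ^ J * a)) := by ring
      have h1 := defectForm_step f hT hN ha hle (by omega : 2 ^ J * a ≤ 2 * (2 ^ J * a)) le_rfl
      have h2 := avgRate_le_tailRate_sub hb hs hpos
      have h3 := avgRate_le_tailRate_sub hb hs (by omega : 1 ≤ 2 * (2 ^ J * a))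
      have e3 : (a : ℝ) / ((2 ^ J * a : ℕ) : ℝ) = (2 ^ J : ℝ)⁻¹ := by
        have : (a : ℝ) ≠ 0 := by positivity
        push_cast; field_simp
      have e4 : ((2 : ℝ) ^ (J + 1))⁻¹ = (2 ^ J : ℝ)⁻¹ / 2 := by
        rw [pow_succ, mul_inv]; ring
      rw [e3] at h1
      rw [e1] at ih ⊢
      rw [e2, e4]
      linarith
  have h1 := avgRate_le_tailRate hb hs ha
  have h2 := tailRate_nonneg hb (2 ^ J * a)
  have h3 := tailRate_nonneg hb (2 ^ (J + 1) * a)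
  have h4 : R (2 * a) ≤ R a := tailRate_antitone hb hs (by omega)
  have h5 : 0 ≤ (2 ^ J : ℝ)⁻¹ * ε a := mul_nonneg (by positivity) (avgRate_nonneg hb a)
  linarith

/-- Reaching a power of two from an arbitrary `n` costs a multiple of the rate at `n`. -/
theorem defectForm_bridge_le [CompleteSpace H] (hT : ‖T‖ ≤ 1) (hN : IsStarNormal T)
    (hs : Summable fun k : ℕ => orbitSq T f k / (k : ℝ) ^ 2) {n N : ℕ} (hn : 1 ≤ n)
    (hnN : n ≤ N) (hN2 : N ≤ 2 * n) :
    defectForm T (poissonApprox T f N - poissonApprox T f n)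
        (poissonApprox T f N - poissonApprox T f n)
      ≤ 104 * tailRate (orbitSq T f) n := by
  have hb := orbitSq_nonneg T f
  have h1 := defectForm_step f hT hN hn le_rfl hnN hN2
  have h2 := avgRate_le_tailRate hb hs hn
  have h3 := avgRate_le_tailRate hb hs (hn.trans hnN)
  have h4 : tailRate (orbitSq T f) N ≤ tailRate (orbitSq T f) n := tailRate_antitone hb hs hnN
  have h5 : (n : ℝ) / n = 1 := div_self (by positivity)
  rw [h5, sub_self, show defectForm T 0 0 = 0 by simp [defectForm]] at h1
  linarith

/-- If the defect form is realized as the squared norm of `D x` in a Hilbert space, then `D h_n`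
converges along powers of two, and its limit is within the rate of every `D h_n`. -/
theorem exists_limit_of_defectForm [CompleteSpace H] {K : Type*} [NormedAddCommGroup K]
    [InnerProductSpace ℝ K] [CompleteSpace K] (hT : ‖T‖ ≤ 1) (hN : IsStarNormal T)
    (hs : Summable fun k : ℕ => orbitSq T f k / (k : ℝ) ^ 2) (D : H →ₗ[ℝ] K)
    (hD : ∀ x, ‖D x‖ ^ 2 = defectForm T x x) :
    ∃ G : K, Tendsto (fun j : ℕ => D (poissonApprox T f (2 ^ j))) atTop (nhds G) ∧
      ∀ n : ℕ, 1 ≤ n → ‖D (poissonApprox T f n) - G‖ ^ 2 ≤ 432 * tailRate (orbitSq T f) n := by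
  have hb := orbitSq_nonneg T f
  set R := tailRate (orbitSq T f) with hR
  have h1 : ∀ i j : ℕ, i ≤ j →
      ‖D (poissonApprox T f (2 ^ j)) - D (poissonApprox T f (2 ^ i))‖ ^ 2 ≤ 112 * R (2 ^ i) := by
    intro i j hij
    rw [← map_sub, hD]
    have := defectForm_pow_two_le f hT hN hs (a := 2 ^ i) Nat.one_le_two_pow (j - i)
    rwa [← pow_add, Nat.sub_add_cancel hij] at this
  have h2 : CauchySeq fun j : ℕ => D (poissonApprox T f (2 ^ j)) := by
    refine cauchySeq_of_le_tendsto_0 (fun i => 2 * √(112 * R (2 ^ i))) (fun i j k hi hj => ?_) ?_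
    · have e : ∀ l, k ≤ l →
          ‖D (poissonApprox T f (2 ^ l)) - D (poissonApprox T f (2 ^ k))‖
            ≤ √(112 * R (2 ^ k)) := fun l hl => Real.le_sqrt_of_sq_le (h1 k l hl)
      rw [dist_eq_norm, ← sub_sub_sub_cancel_right _ _ (D (poissonApprox T f (2 ^ k)))]
      have := norm_sub_le (D (poissonApprox T f (2 ^ i)) - D (poissonApprox T f (2 ^ k)))
        (D (poissonApprox T f (2 ^ j)) - D (poissonApprox T f (2 ^ k)))
      have := e i hi
      have := e j hj
      linarith
    · have e1 : Tendsto (fun i : ℕ => R (2 ^ i)) atTop (nhds 0) :=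
        (tendsto_tailRate hb hs).comp (tendsto_pow_atTop_atTop_of_one_lt one_lt_two)
      have e2 := ((e1.const_mul 112).sqrt).const_mul 2
      simpa using e2
  obtain ⟨G, hG⟩ := cauchySeq_tendsto_of_complete h2
  refine ⟨G, hG, fun n hn => ?_⟩
  obtain ⟨i, hi1, hi2⟩ : ∃ i : ℕ, n ≤ 2 ^ i ∧ 2 ^ i ≤ 2 * n := by
    refine ⟨Nat.log 2 n + 1, (Nat.lt_pow_succ_log_self one_lt_two n).le, ?_⟩
    rw [pow_succ, mul_comm]
    exact Nat.mul_le_mul_left 2 (Nat.pow_log_le_self 2 (by omega))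
  have h3 : ‖G - D (poissonApprox T f (2 ^ i))‖ ^ 2 ≤ 112 * R (2 ^ i) := by
    refine le_of_tendsto ((hG.sub_const _).norm.pow 2) ?_
    filter_upwards [eventually_ge_atTop i] with j hj using h1 i j hj
  have h4 : ‖D (poissonApprox T f (2 ^ i)) - D (poissonApprox T f n)‖ ^ 2 ≤ 104 * R n := by
    rw [← map_sub, hD]
    exact defectForm_bridge_le f hT hN hs hn hi1 hi2
  have h5 : R (2 ^ i) ≤ R n := tailRate_antitone hb hs hi1
  have h6 : ‖D (poissonApprox T f n) - G‖ ≤ ‖G - D (poissonApprox T f (2 ^ i))‖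
      + ‖D (poissonApprox T f (2 ^ i)) - D (poissonApprox T f n)‖ := by
    rw [norm_sub_rev]
    exact norm_sub_le_norm_sub_add_norm_sub _ _ _
  nlinarith [norm_nonneg (D (poissonApprox T f n) - G),
    sq_nonneg (‖G - D (poissonApprox T f (2 ^ i))‖
      - ‖D (poissonApprox T f (2 ^ i)) - D (poissonApprox T f n)‖)]

end Hilbert


/-! ### One step of a Markov chain -/

section Step

variable {S Ω : Type*} [MeasurableSpace S] {mΩ : MeasurableSpace Ω}
  {κ : Kernel S S} [IsMarkovKernel κ] {m : Measure S} [IsProbabilityMeasure m]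
  {μ : Measure Ω} [IsProbabilityMeasure μ] {ℱ : Filtration ℕ mΩ} {W : ℕ → Ω → S}

/-- The pair `(W_n, W_{n+1})` of consecutive states of a trajectory. -/
def stepPair (W : ℕ → Ω → S) (n : ℕ) (ω : Ω) : S × S := (W n ω, W (n + 1) ω)

theorem IsMarkovChain.measurable {κ : Kernel S S} {m : Measure S} {μ : Measure Ω} (hW : IsMarkovChain κ m ℱ μ W) (n : ℕ) : Measurable (W n) :=
  (hW.adapted n).mono (ℱ.le n) le_rfl

theorem IsMarkovChain.measurable_stepPair {κ : Kernel S S} {m : Measure S} {μ : Measure Ω}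
    (hW : IsMarkovChain κ m ℱ μ W) (n : ℕ) :
    Measurable (stepPair W n) :=
  (hW.measurable n).prodMk (hW.measurable (n + 1))

/-- The Markov property as a disintegration, on every event of the past. -/
theorem IsMarkovChain.map_stepPair_restrict {m : Measure S} (hW : IsMarkovChain κ m ℱ μ W) (n : ℕ) {F : Set Ω}
    (hF : MeasurableSet[ℱ n] F) :
    (μ.restrict F).map (stepPair W n) = ((μ.restrict F).map (W n)) ⊗ₘ κ := by
  have hmn := hW.measurable n
  have hmn1 := hW.measurable (n + 1)
  refine Measure.ext_prod fun {A B} hA hB => ?_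
  set s : Set Ω := W n ⁻¹' A ∩ F with hs
  have hsn : MeasurableSet[ℱ n] s := (hW.adapted n hA).inter hF
  have hsm : MeasurableSet s := ℱ.le n _ hsn
  rw [Measure.map_apply (hW.measurable_stepPair n) (hA.prod hB),
    Measure.compProd_apply_prod hA hB,
    setLIntegral_map hA (κ.measurable_coe hB) hmn, Measure.restrict_restrict (hmn hA), ← hs]
  have e1 : μ.restrict F (stepPair W n ⁻¹' A ×ˢ B) = μ (W (n + 1) ⁻¹' B ∩ s) := by
    rw [Measure.restrict_apply (hW.measurable_stepPair n (hA.prod hB))]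
    congr 1
    ext ω
    simp only [stepPair, hs, Set.mem_inter_iff, Set.mem_preimage, Set.mem_prod]
    tauto
  -- `s` is an event of the past of `n`, so the Markov property can be integrated over it.
  have e2 := setIntegral_condExp (ℱ.le n) (μ := μ) (s := s)
    (f := (W (n + 1) ⁻¹' B).indicator fun _ => (1 : ℝ))
    ((integrable_const _).indicator (hmn1 hB)) hsn
  rw [setIntegral_congr_ae hsm ((hW.markov n B hB).mono fun ω h _ => h),
    integral_indicator_const _ (hmn1 hB), measureReal_restrict_apply (hmn1 hB), smul_eq_mul,
    mul_one] at e2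
  have e3 : ∫ ω in s, (κ (W n ω)).real B ∂μ = (∫⁻ ω in s, κ (W n ω) B ∂μ).toReal :=
    integral_toReal ((κ.measurable_coe hB).comp hmn).aemeasurable
      (Eventually.of_forall fun ω => measure_lt_top _ _)
  have e4 : ∫⁻ ω in s, κ (W n ω) B ∂μ ≠ ∞ := by
    refine ne_top_of_le_ne_top (measure_ne_top μ s) ?_
    calc ∫⁻ ω in s, κ (W n ω) B ∂μ ≤ ∫⁻ _ in s, 1 ∂μ := lintegral_mono fun ω => prob_le_one
      _ = μ s := by simp
  rw [e1]
  refine (ENNReal.toReal_eq_toReal_iff' (measure_ne_top _ _) e4).1 ?_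
  rw [← e3, e2]
  rfl

theorem measurePreserving_fst_compProd (κ : Kernel S S) [IsMarkovKernel κ] (m : Measure S)
    [IsProbabilityMeasure m] : MeasurePreserving Prod.fst (m ⊗ₘ κ) m :=
  ⟨measurable_fst, Measure.fst_compProd m κ⟩

theorem measurePreserving_snd_compProd (hm : κ.Invariant m) :
    MeasurePreserving Prod.snd (m ⊗ₘ κ) m :=
  ⟨measurable_snd, (Measure.snd_compProd m κ).trans hm.def⟩

theorem IsMarkovChain.measurePreserving (hW : IsMarkovChain κ m ℱ μ W) (hm : κ.Invariant m)
    (n : ℕ) : MeasurePreserving (W n) μ m := by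
  induction n with
  | zero => exact ⟨hW.measurable 0, hW.initial⟩
  | succ n ih =>
    refine ⟨hW.measurable (n + 1), ?_⟩
    have h := hW.map_stepPair_restrict n MeasurableSet.univ
    rw [Measure.restrict_univ, ih.map_eq] at h
    rw [← (measurePreserving_snd_compProd hm).map_eq, ← h,
      Measure.map_map measurable_snd (hW.measurable_stepPair n)]
    rfl

theorem IsMarkovChain.measurePreserving_stepPair (hW : IsMarkovChain κ m ℱ μ W)
    (hm : κ.Invariant m) (n : ℕ) : MeasurePreserving (stepPair W n) μ (m ⊗ₘ κ) := by
  refine ⟨hW.measurable_stepPair n, ?_⟩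
  have h := hW.map_stepPair_restrict n MeasurableSet.univ
  rwa [Measure.restrict_univ, (hW.measurePreserving hm n).map_eq] at h

/-- Conditioning on the past: `∫_F h(W_{n+1}) = ∫_F (P h)(W_n)` for `F` in the past of `n`. -/
theorem IsMarkovChain.setIntegral_succ (hW : IsMarkovChain κ m ℱ μ W) (hm : κ.Invariant m)
    (n : ℕ) {F : Set Ω} (hF : MeasurableSet[ℱ n] F) (h : Lp ℝ 2 m) :
    ∫ ω in F, h (W (n + 1) ω) ∂μ = ∫ ω in F, markovOp ℝ κ m hm h (W n ω) ∂μ := by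
  have hmn := hW.measurable n
  have e0 := hW.map_stepPair_restrict n hF
  have hh : StronglyMeasurable fun z : S × S => h z.2 :=
    (Lp.stronglyMeasurable h).comp_measurable measurable_snd
  have hi : Integrable (fun ω => h (W (n + 1) ω)) (μ.restrict F) :=
    (((Lp.memLp h).comp_measurePreserving (hW.measurePreserving hm (n + 1))).integrable
      (by norm_num)).integrableOn
  have hi2 : Integrable (fun z : S × S => h z.2) (((μ.restrict F).map (W n)) ⊗ₘ κ) := by
    rw [← e0, integrable_map_measure hh.aestronglyMeasurable
      (hW.measurable_stepPair n).aemeasurable]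
    exact hi
  have e1 : ∫ ω in F, h (W (n + 1) ω) ∂μ
      = ∫ z, h z.2 ∂((μ.restrict F).map (stepPair W n)) :=
    (integral_map (hW.measurable_stepPair n).aemeasurable hh.aestronglyMeasurable).symm
  have e2 := coeFn_markovOp κ m hm h
  rw [e1, e0, Measure.integral_compProd hi2,
    integral_map hmn.aemeasurable hh.integral_kernel_prod_right'.aestronglyMeasurable]
  have e3 := (hW.measurePreserving hm n).quasiMeasurePreserving.ae_eq_comp e2
  exact (integral_congr_ae (ae_restrict_of_ae e3)).symm

end Step

/-! ### The martingale difference of a function on the state space -/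

section MartingaleDifference

variable {S Ω : Type*} [MeasurableSpace S] {mΩ : MeasurableSpace Ω}
  {κ : Kernel S S} [IsMarkovKernel κ] {m : Measure S} [IsProbabilityMeasure m]
  {μ : Measure Ω} [IsProbabilityMeasure μ] {ℱ : Filtration ℕ mΩ} {W : ℕ → Ω → S}

theorem norm_markovOp_le (hm : κ.Invariant m) : ‖markovOp ℝ κ m hm‖ ≤ 1 :=
  LinearMap.mkContinuous_norm_le _ zero_le_one _

/-- The map `h ↦ ((x, y) ↦ h(y) - (P h)(x))` from `L²(m)` to `L²` of the law `m ⊗ κ` of two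
consecutive states. -/
def martingaleDiff (hm : κ.Invariant m) : Lp ℝ 2 m →ₗ[ℝ] Lp ℝ 2 (m ⊗ₘ κ) :=
  (Lp.compMeasurePreservingₗᵢ ℝ Prod.snd (measurePreserving_snd_compProd hm)).toLinearMap
    - (Lp.compMeasurePreservingₗᵢ ℝ Prod.fst
        (measurePreserving_fst_compProd κ m)).toLinearMap ∘ₗ (markovOp ℝ κ m hm).toLinearMap

theorem martingaleDiff_apply (hm : κ.Invariant m) (h : Lp ℝ 2 m) :
    martingaleDiff hm h
      = Lp.compMeasurePreservingₗᵢ ℝ Prod.snd (measurePreserving_snd_compProd hm) h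
        - Lp.compMeasurePreservingₗᵢ ℝ Prod.fst (measurePreserving_fst_compProd κ m)
            (markovOp ℝ κ m hm h) := rfl

theorem coeFn_compMeasurePreservingₗᵢ {α β : Type*} [MeasurableSpace α] [MeasurableSpace β]
    {p : Measure α} {q : Measure β} {φ : α → β} (hφ : MeasurePreserving φ p q) (g : Lp ℝ 2 q) :
    Lp.compMeasurePreservingₗᵢ ℝ φ hφ g =ᵐ[p] g ∘ φ :=
  Lp.coeFn_compMeasurePreserving g hφ

/-- `⟪φ(x), h(y)⟫ = ⟪φ, P h⟫` for the law of two consecutive states. -/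
theorem inner_fst_snd (hm : κ.Invariant m) (φ h : Lp ℝ 2 m) :
    inner ℝ (Lp.compMeasurePreservingₗᵢ ℝ Prod.fst (measurePreserving_fst_compProd κ m) φ)
      (Lp.compMeasurePreservingₗᵢ ℝ Prod.snd (measurePreserving_snd_compProd hm) h)
      = inner ℝ φ (markovOp ℝ κ m hm h) := by
  have h1 := coeFn_compMeasurePreservingₗᵢ (measurePreserving_fst_compProd κ m) φ
  have h2 := coeFn_compMeasurePreservingₗᵢ (measurePreserving_snd_compProd hm) h
  have h3 := coeFn_markovOp κ m hm h
  have hi : Integrable (fun z : S × S => h z.2 * φ z.1) (m ⊗ₘ κ) :=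
    ((Lp.memLp h).comp_measurePreserving (measurePreserving_snd_compProd hm)).integrable_mul
      ((Lp.memLp φ).comp_measurePreserving (measurePreserving_fst_compProd κ m))
  rw [L2.inner_def, L2.inner_def]
  calc _ = ∫ z : S × S, h z.2 * φ z.1 ∂(m ⊗ₘ κ) := by
        refine integral_congr_ae ?_
        filter_upwards [h1, h2] with z e1 e2
        rw [e1, e2]
        rfl
    _ = ∫ x, ∫ y, h y * φ x ∂(κ x) ∂m := Measure.integral_compProd hi
    _ = _ := by
        refine integral_congr_ae ?_
        filter_upwards [h3] with x e3
        rw [e3, integral_mul_const]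
        rfl

theorem norm_martingaleDiff_sq (hm : κ.Invariant m) (h : Lp ℝ 2 m) :
    ‖martingaleDiff hm h‖ ^ 2 = defectForm (markovOp ℝ κ m hm) h h := by
  rw [martingaleDiff_apply, norm_sub_sq_real, real_inner_comm, inner_fst_snd hm, defectForm,
    real_inner_self_eq_norm_sq, real_inner_self_eq_norm_sq, LinearIsometry.norm_map,
    LinearIsometry.norm_map]
  ring

/-- Evaluation `h ↦ h(W_n)` as an isometry from `L²(m)` to `L²(μ)`. -/
def evalState (hW : IsMarkovChain κ m ℱ μ W) (hm : κ.Invariant m) (n : ℕ) :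
    Lp ℝ 2 m →ₗᵢ[ℝ] Lp ℝ 2 μ :=
  Lp.compMeasurePreservingₗᵢ ℝ (W n) (hW.measurePreserving hm n)

/-- Evaluation `G ↦ G(W_n, W_{n+1})` as an isometry from `L²(m ⊗ κ)` to `L²(μ)`. -/
def evalStep (hW : IsMarkovChain κ m ℱ μ W) (hm : κ.Invariant m) (n : ℕ) :
    Lp ℝ 2 (m ⊗ₘ κ) →ₗᵢ[ℝ] Lp ℝ 2 μ :=
  Lp.compMeasurePreservingₗᵢ ℝ (stepPair W n) (hW.measurePreserving_stepPair hm n)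

theorem coeFn_evalState (hW : IsMarkovChain κ m ℱ μ W) (hm : κ.Invariant m) (n : ℕ)
    (h : Lp ℝ 2 m) : evalState hW hm n h =ᵐ[μ] fun ω => h (W n ω) :=
  coeFn_compMeasurePreservingₗᵢ (hW.measurePreserving hm n) h

theorem coeFn_evalStep (hW : IsMarkovChain κ m ℱ μ W) (hm : κ.Invariant m) (n : ℕ)
    (G : Lp ℝ 2 (m ⊗ₘ κ)) : evalStep hW hm n G =ᵐ[μ] fun ω => G (stepPair W n ω) :=
  coeFn_compMeasurePreservingₗᵢ (hW.measurePreserving_stepPair hm n) G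

theorem evalStep_martingaleDiff (hW : IsMarkovChain κ m ℱ μ W) (hm : κ.Invariant m) (n : ℕ)
    (h : Lp ℝ 2 m) :
    evalStep hW hm n (martingaleDiff hm h)
      = evalState hW hm (n + 1) h - evalState hW hm n (markovOp ℝ κ m hm h) := by
  rw [martingaleDiff_apply, map_sub]
  congr 1
  refine Lp.ext ((coeFn_evalStep hW hm n _).trans
    (EventuallyEq.trans ?_ (coeFn_evalState hW hm (n + 1) h).symm))
  exact (hW.measurePreserving_stepPair hm n).quasiMeasurePreserving.ae_eq_comp
    (coeFn_compMeasurePreservingₗᵢ (measurePreserving_snd_compProd hm) h)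

/-- The functions `G` of two consecutive states for which `G(W_n, W_{n+1})` is centred on every
event of the past of `n`. -/
def centredSteps (hW : IsMarkovChain κ m ℱ μ W) (hm : κ.Invariant m) :
    Submodule ℝ (Lp ℝ 2 (m ⊗ₘ κ)) :=
  ⨅ (n : ℕ) (F : Set Ω) (hF : MeasurableSet[ℱ n] F),
    ((innerSL ℝ (indicatorConstLp 2 (ℱ.le n F hF) (measure_ne_top μ F) (1 : ℝ))).comp
      (evalStep hW hm n).toContinuousLinearMap).ker

theorem mem_centredSteps {hW : IsMarkovChain κ m ℱ μ W} {hm : κ.Invariant m}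
    {G : Lp ℝ 2 (m ⊗ₘ κ)} : G ∈ centredSteps hW hm ↔
      ∀ (n : ℕ) (F : Set Ω), MeasurableSet[ℱ n] F → ∫ ω in F, evalStep hW hm n G ω ∂μ = 0 := by
  simp [centredSteps, Submodule.mem_iInf, L2.inner_indicatorConstLp_one]

theorem isClosed_centredSteps (hW : IsMarkovChain κ m ℱ μ W) (hm : κ.Invariant m) :
    IsClosed (centredSteps hW hm : Set (Lp ℝ 2 (m ⊗ₘ κ))) := by
  simp only [centredSteps, Submodule.coe_iInf]
  exact isClosed_iInter fun n => isClosed_iInter fun F => isClosed_iInter fun hF =>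
    ContinuousLinearMap.isClosed_ker _

theorem martingaleDiff_mem_centredSteps (hW : IsMarkovChain κ m ℱ μ W) (hm : κ.Invariant m)
    (h : Lp ℝ 2 m) : martingaleDiff hm h ∈ centredSteps hW hm := by
  rw [mem_centredSteps]
  intro n F hF
  rw [evalStep_martingaleDiff, integral_congr_ae (ae_restrict_of_ae (Lp.coeFn_sub _ _))]
  simp only [Pi.sub_apply]
  have hi : ∀ g : Lp ℝ 2 μ, Integrable g (μ.restrict F) := fun g =>
    ((Lp.memLp g).integrable (by norm_num)).integrableOn
  rw [integral_sub (hi _) (hi _), sub_eq_zero,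
    integral_congr_ae (ae_restrict_of_ae (coeFn_evalState hW hm (n + 1) h)),
    integral_congr_ae (ae_restrict_of_ae (coeFn_evalState hW hm n _))]
  exact hW.setIntegral_succ hm n hF h

/-- A centred step at time `n` is orthogonal to every square integrable function of the past. -/
theorem inner_evalStep_eq_zero (hW : IsMarkovChain κ m ℱ μ W) (hm : κ.Invariant m)
    {G : Lp ℝ 2 (m ⊗ₘ κ)} (hG : G ∈ centredSteps hW hm) (n : ℕ) {Y : Lp ℝ 2 μ}
    (hY : AEStronglyMeasurable[ℱ n] Y μ) : inner ℝ Y (evalStep hW hm n G) = 0 := by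
  set X := evalStep hW hm n G with hX
  have hXi : Integrable X μ := (Lp.memLp X).integrable (by norm_num)
  have hXY : Integrable ((Y : Ω → ℝ) * (X : Ω → ℝ)) μ := (Lp.memLp Y).integrable_mul (Lp.memLp X)
  have h0 : (0 : Ω → ℝ) =ᵐ[μ] μ[X | ℱ n] :=
    ae_eq_condExp_of_forall_setIntegral_eq (ℱ.le n) hXi
      (fun s _ _ => integrableOn_zero)
      (fun s hs _ => by simp [hX, (mem_centredSteps.1 hG) n s hs])
      aestronglyMeasurable_zero
  have h1 : μ[(Y : Ω → ℝ) * (X : Ω → ℝ) | ℱ n] =ᵐ[μ] 0 := by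
    refine (condExp_mul_of_aestronglyMeasurable_left hY hXY hXi).trans ?_
    filter_upwards [h0] with ω e
    simp [← e]
  rw [L2.inner_def]
  have h2 : ∫ ω, inner ℝ (Y ω) (X ω) ∂μ = ∫ ω, ((Y : Ω → ℝ) * (X : Ω → ℝ)) ω ∂μ := by
    refine integral_congr_ae (Eventually.of_forall fun ω => ?_)
    simp [mul_comm]
  rw [h2, ← integral_condExp (ℱ.le n), integral_congr_ae h1]
  simp

theorem aestronglyMeasurable_evalStep (hW : IsMarkovChain κ m ℱ μ W) (hm : κ.Invariant m)
    (G : Lp ℝ 2 (m ⊗ₘ κ)) {k n : ℕ} (hkn : k < n) :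
    AEStronglyMeasurable[ℱ n] (evalStep hW hm k G) μ := by
  have h1 : Measurable[ℱ n] (stepPair W k) :=
    Measurable.prodMk ((hW.adapted k).mono (ℱ.mono hkn.le) le_rfl)
      ((hW.adapted (k + 1)).mono (ℱ.mono hkn) le_rfl)
  exact ⟨_, (Lp.stronglyMeasurable G).comp_measurable h1, coeFn_evalStep hW hm k G⟩

/-- Orthogonality of the increments of a stationary martingale. -/
theorem norm_sum_evalStep_sq (hW : IsMarkovChain κ m ℱ μ W) (hm : κ.Invariant m)
    {G : Lp ℝ 2 (m ⊗ₘ κ)} (hG : G ∈ centredSteps hW hm) (n : ℕ) :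
    ‖∑ k ∈ Finset.range n, evalStep hW hm k G‖ ^ 2 = n * ‖G‖ ^ 2 := by
  induction n with
  | zero => simp
  | succ n ih =>
    have h0 : inner ℝ (∑ k ∈ Finset.range n, evalStep hW hm k G) (evalStep hW hm n G) = 0 := by
      rw [sum_inner]
      exact Finset.sum_eq_zero fun k hk => inner_evalStep_eq_zero hW hm hG n
        (aestronglyMeasurable_evalStep hW hm G (Finset.mem_range.1 hk))
    rw [Finset.sum_range_succ, norm_add_sq_real, h0, ih, LinearIsometry.norm_map]
    push_cast
    ring

end MartingaleDifference

/-! ### The approximating martingale -/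

section Approximation

variable {S Ω : Type*} [MeasurableSpace S] {mΩ : MeasurableSpace Ω}
  {κ : Kernel S S} [IsMarkovKernel κ] {m : Measure S} [IsProbabilityMeasure m]
  {μ : Measure Ω} [IsProbabilityMeasure μ] {ℱ : Filtration ℕ mΩ} {W : ℕ → Ω → S}

/-- A function of two consecutive states as a function of the first two coordinates of a path. -/
def pathStep (G : S × S → ℝ) (x : ℕ → S) : ℝ := G (x 0, x 1)

theorem iterate_shift_apply {S : Type*} (k : ℕ) (x : ℕ → S) (i : ℕ) : (shift^[k] x) i = x (k + i) := by
  induction k generalizing x with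
  | zero => simp
  | succ k ih =>
    rw [Function.iterate_succ_apply, ih, shift]
    congr 1
    omega

theorem stationarySum_pathStep {S Ω : Type*} (W : ℕ → Ω → S) (G : S × S → ℝ) (n : ℕ) (ω : Ω) :
    stationarySum W (pathStep G) n ω = ∑ k ∈ Finset.range n, G (stepPair W k ω) := by
  simp only [stationarySum, pathStep, iterate_shift_apply]
  rfl

theorem coeFn_sum_evalStep (hW : IsMarkovChain κ m ℱ μ W) (hm : κ.Invariant m)
    (G : Lp ℝ 2 (m ⊗ₘ κ)) (n : ℕ) :
    (∑ k ∈ Finset.range n, evalStep hW hm k G : Lp ℝ 2 μ)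
      =ᵐ[μ] stationarySum W (pathStep G) n := by
  refine (Lp.coeFn_finsetSum _ _).trans ?_
  filter_upwards [ae_all_iff.2 fun k => coeFn_evalStep hW hm k G] with ω e
  rw [stationarySum_pathStep, Finset.sum_apply]
  exact Finset.sum_congr rfl fun k _ => e k

theorem coeFn_sum_evalState (hW : IsMarkovChain κ m ℱ μ W) (hm : κ.Invariant m)
    {f : S → ℝ} (hf : MemLp f 2 m) (n : ℕ) :
    (∑ k ∈ Finset.range n, evalState hW hm (k + 1) (hf.toLp f) : Lp ℝ 2 μ)
      =ᵐ[μ] partialSum W f n := by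
  refine (Lp.coeFn_finsetSum _ _).trans ?_
  have h : ∀ k, ∀ᵐ ω ∂μ, hf.toLp f (W (k + 1) ω) = f (W (k + 1) ω) := fun k =>
    (hW.measurePreserving hm (k + 1)).quasiMeasurePreserving.ae_eq_comp hf.coeFn_toLp
  filter_upwards [ae_all_iff.2 fun k => coeFn_evalState hW hm (k + 1) (hf.toLp f),
    ae_all_iff.2 h] with ω e e'
  have h1 : Finset.Icc 1 n = Finset.Ico 1 (n + 1) := by ext; simp
  rw [Finset.sum_apply, partialSum, h1, Finset.sum_Ico_eq_sum_range, Nat.add_sub_cancel]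
  refine Finset.sum_congr rfl fun k _ => ?_
  rw [e, e', add_comm]

theorem memLp_pathStep (hW : IsMarkovChain κ m ℱ μ W) (hm : κ.Invariant m)
    (G : Lp ℝ 2 (m ⊗ₘ κ)) : MemLp (pathStep G) 2 (μ.map (path W)) := by
  have hp : Measurable (path W) := measurable_pi_lambda _ hW.measurable
  have hG : StronglyMeasurable (pathStep (S := S) G) :=
    (Lp.stronglyMeasurable G).comp_measurable
      ((measurable_pi_apply 0).prodMk (measurable_pi_apply 1))
  rw [memLp_map_measure_iff hG.aestronglyMeasurable hp.aemeasurable]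
  exact (Lp.memLp G).comp_measurePreserving (hW.measurePreserving_stepPair hm 0)

theorem martingale_stationarySum (hW : IsMarkovChain κ m ℱ μ W) (hm : κ.Invariant m)
    {G : Lp ℝ 2 (m ⊗ₘ κ)} (hG : G ∈ centredSteps hW hm) :
    Martingale (stationarySum W (pathStep G)) ℱ μ := by
  have hi : ∀ n, Integrable (stationarySum W (pathStep G) n) μ := fun n =>
    ((Lp.memLp _).integrable (by norm_num)).congr (coeFn_sum_evalStep hW hm G n)
  refine martingale_of_setIntegral_eq_succ (fun n => ?_) hi fun n F hF => ?_
  · have e : stationarySum W (pathStep G) n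
        = fun ω => ∑ k ∈ Finset.range n, G (stepPair W k ω) :=
      funext (stationarySum_pathStep W G n)
    rw [e]
    refine Finset.stronglyMeasurable_fun_sum _ fun k hk => ?_
    rw [Finset.mem_range] at hk
    exact (Lp.stronglyMeasurable G).comp_measurable
      (Measurable.prodMk ((hW.adapted k).mono (ℱ.mono hk.le) le_rfl)
        ((hW.adapted (k + 1)).mono (ℱ.mono hk) le_rfl))
  · have e : ∀ ω, stationarySum W (pathStep G) (n + 1) ω
        = stationarySum W (pathStep G) n ω + G (stepPair W n ω) := fun ω => by
      rw [stationarySum_pathStep, stationarySum_pathStep, Finset.sum_range_succ]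
    have h0 := (mem_centredSteps.1 hG) n F hF
    rw [integral_congr_ae (ae_restrict_of_ae (coeFn_evalStep hW hm n G))] at h0
    have hi' : Integrable (fun ω => G (stepPair W n ω)) μ :=
      ((Lp.memLp _).integrable (by norm_num)).congr (coeFn_evalStep hW hm n G)
    simp only [e]
    rw [integral_add (hi n).integrableOn hi'.integrableOn, h0, add_zero]

/-- The telescoping identity `S_n(f) - M_n = (P h_n)(W_0) - (P h_n)(W_n) + ∑ (U_n / n)(W_k)` for the
martingale `M_n` built on `h_n`, from `f = h_n - P h_n + U_n / n`. -/
theorem sum_evalState_sub (hW : IsMarkovChain κ m ℱ μ W) (hm : κ.Invariant m) (f : Lp ℝ 2 m)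
    {n : ℕ} (hn : 1 ≤ n) :
    ∑ k ∈ Finset.range n, evalState hW hm (k + 1) f
        - ∑ k ∈ Finset.range n,
            evalStep hW hm k (martingaleDiff hm (poissonApprox (markovOp ℝ κ m hm) f n))
      = evalState hW hm 0 (markovOp ℝ κ m hm (poissonApprox (markovOp ℝ κ m hm) f n))
        - evalState hW hm n (markovOp ℝ κ m hm (poissonApprox (markovOp ℝ κ m hm) f n))
        + ∑ k ∈ Finset.range n,
            evalState hW hm (k + 1) ((n : ℝ)⁻¹ • orbitSum (markovOp ℝ κ m hm) f n) := by
  set h := poissonApprox (markovOp ℝ κ m hm) f n with hh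
  set g := markovOp ℝ κ m hm h with hg
  set v := (n : ℝ)⁻¹ • orbitSum (markovOp ℝ κ m hm) f n with hv
  have hf : f = h - g + v := by
    rw [hg, hh, poissonApprox_sub_map _ f hn]; abel
  have e : ∀ k, evalState hW hm (k + 1) f - evalStep hW hm k (martingaleDiff hm h)
      = evalState hW hm (k + 1) v + (evalState hW hm k g - evalState hW hm (k + 1) g) := by
    intro k
    rw [evalStep_martingaleDiff, ← hg]
    conv_lhs => rw [hf]
    rw [map_add, map_sub]
    abel
  rw [← Finset.sum_sub_distrib, Finset.sum_congr rfl fun k _ => e k, Finset.sum_add_distrib,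
    Finset.sum_range_sub' (fun k => evalState hW hm k g)]
  abel

/-- Comparison of `S_n(f)` with the martingale of `G` through the martingale of `h_n`: the first
distance is at most `2 ‖P h_n‖ + ‖U_n‖`, the second is `√n` times the distance of the increments. -/
theorem norm_sum_evalState_sub_sum_evalStep_sq_le (hW : IsMarkovChain κ m ℱ μ W)
    (hm : κ.Invariant m) (f : Lp ℝ 2 m)
    (hs : Summable fun k : ℕ => orbitSq (markovOp ℝ κ m hm) f k / (k : ℝ) ^ 2)
    {G : Lp ℝ 2 (m ⊗ₘ κ)} (hG : G ∈ centredSteps hW hm) {n : ℕ} (hn : 1 ≤ n)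
    (hGn : ‖martingaleDiff hm (poissonApprox (markovOp ℝ κ m hm) f n) - G‖ ^ 2
      ≤ 432 * tailRate (orbitSq (markovOp ℝ κ m hm) f) n) :
    ‖∑ k ∈ Finset.range n, evalState hW hm (k + 1) f
        - ∑ k ∈ Finset.range n, evalStep hW hm k G‖ ^ 2
      ≤ 928 * (n * tailRate (orbitSq (markovOp ℝ κ m hm) f) n) := by
  set T := markovOp ℝ κ m hm with hT
  set h := poissonApprox T f n with hh
  have hT1 : ‖T‖ ≤ 1 := norm_markovOp_le hm
  have hn0 : (0 : ℝ) < n := by positivity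
  set X := ∑ k ∈ Finset.range n, evalState hW hm (k + 1) f
        - ∑ k ∈ Finset.range n, evalStep hW hm k (martingaleDiff hm h) with hX
  set Z := ∑ k ∈ Finset.range n, evalStep hW hm k (martingaleDiff hm h - G) with hZ
  have e1 : ∑ k ∈ Finset.range n, evalState hW hm (k + 1) f
        - ∑ k ∈ Finset.range n, evalStep hW hm k G = X + Z := by
    rw [hX, hZ]
    simp only [map_sub, Finset.sum_sub_distrib]
    abel
  have hZ2 : ‖Z‖ ^ 2 ≤ n * (432 * tailRate (orbitSq T f) n) := by
    rw [hZ, norm_sum_evalStep_sq hW hm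
      ((centredSteps hW hm).sub_mem (martingaleDiff_mem_centredSteps hW hm h) hG)]
    gcongr
  have hX1 : ‖X‖ ≤ 4 * orbitRms T f n := by
    rw [hX, sum_evalState_sub hW hm f hn]
    have h1 := norm_map_poissonApprox_le T f hn
    have h2 := norm_orbitSum_le f hT1 hn
    have h3 : ‖∑ k ∈ Finset.range n, evalState hW hm (k + 1) ((n : ℝ)⁻¹ • orbitSum T f n)‖
        ≤ ‖orbitSum T f n‖ := by
      refine (norm_sum_le _ _).trans_eq ?_
      simp only [LinearIsometry.norm_map, Finset.sum_const, Finset.card_range, nsmul_eq_mul,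
        norm_smul, norm_inv, Real.norm_natCast]
      field_simp
    have h4 := norm_add_le (evalState hW hm 0 (T h) - evalState hW hm n (T h))
      (∑ k ∈ Finset.range n, evalState hW hm (k + 1) ((n : ℝ)⁻¹ • orbitSum T f n))
    have h5 := norm_sub_le (evalState hW hm 0 (T h)) (evalState hW hm n (T h))
    rw [LinearIsometry.norm_map, LinearIsometry.norm_map] at h5
    linarith
  have hX2 : ‖X‖ ^ 2 ≤ 16 * (n * (2 * tailRate (orbitSq T f) n)) := by
    calc ‖X‖ ^ 2 ≤ (4 * orbitRms T f n) ^ 2 := by gcongr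
      _ = 16 * (n * avgRate (orbitSq T f) n) := by rw [mul_pow, orbitRms_sq]; norm_num
      _ ≤ _ := by
        have := avgRate_le_tailRate (orbitSq_nonneg T f) hs hn
        gcongr
  rw [e1]
  have h6 := norm_add_le X Z
  nlinarith [norm_nonneg (X + Z), sq_nonneg (‖X‖ - ‖Z‖)]

end Approximation

end NormalChain

end


theorem mainTheorem12 :
    ∃ C : ℝ, 0 < C ∧
      ∀ (S : Type*) [MeasurableSpace S] (κ : Kernel S S) [IsMarkovKernel κ]
        (m : Measure S) [IsProbabilityMeasure m] (hm : κ.Invariant m)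
        (Ω : Type*) [mΩ : MeasurableSpace Ω] (μ : Measure Ω) [IsProbabilityMeasure μ]
        (ℱ : Filtration ℕ mΩ) (W : ℕ → Ω → S),
        NormalChain.IsMarkovChain κ m ℱ μ W →
        NormalChain.IsStationaryErgodic μ W →
        IsStarNormal (NormalChain.markovOp ℝ κ m hm) →
        ∀ (f : S → ℝ) (hf : MemLp f 2 m),
          Summable (fun n : ℕ =>
            ‖NormalChain.markovSum κ m hm (hf.toLp f) n‖ ^ 2 / (n : ℝ) ^ 2) →
          ∃ M : (ℕ → S) → ℝ,
            NormalChain.IsMartingaleApproximation ℱ μ W f M ∧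
            ∀ n : ℕ, 1 ≤ n →
              MemLp (NormalChain.partialSum W f n - NormalChain.stationarySum W M n) 2 μ ∧
              1 / (n : ℝ) *
                  (eLpNorm (NormalChain.partialSum W f n
                    - NormalChain.stationarySum W M n) 2 μ).toReal ^ 2 ≤
                C * (1 / (n : ℝ) * ∑ k ∈ Finset.Icc 1 n,
                      ‖NormalChain.markovSum κ m hm (hf.toLp f) k‖ ^ 2 / (k : ℝ)
                  + ∑' k : ℕ, ‖NormalChain.markovSum κ m hm (hf.toLp f) (n + 1 + k)‖ ^ 2
                      / ((n + 1 + k : ℕ) : ℝ) ^ 2) := by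
  open NormalChain in
  refine ⟨928, by norm_num, ?_⟩
  intro S _ κ _ m _ hm Ω mΩ μ _ ℱ W hW _ hN f hf hsum
  set T := markovOp ℝ κ m hm with hT
  have hs : Summable fun k : ℕ => orbitSq T (hf.toLp f) k / (k : ℝ) ^ 2 := hsum
  have hb := orbitSq_nonneg T (hf.toLp f)
  obtain ⟨G, hlim, hrate⟩ := exists_limit_of_defectForm (hf.toLp f) (norm_markovOp_le hm) hN hs
    (martingaleDiff hm) (norm_martingaleDiff_sq hm)
  have hG : G ∈ centredSteps hW hm := (isClosed_centredSteps hW hm).mem_of_tendsto hlim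
    (Eventually.of_forall fun j => martingaleDiff_mem_centredSteps hW hm _)
  have hae : ∀ n, (∑ k ∈ Finset.range n, evalState hW hm (k + 1) (hf.toLp f)
        - ∑ k ∈ Finset.range n, evalStep hW hm k G : Lp ℝ 2 μ)
      =ᵐ[μ] partialSum W f n - stationarySum W (pathStep G) n := fun n =>
    (Lp.coeFn_sub _ _).trans
      ((coeFn_sum_evalState hW hm hf n).sub (coeFn_sum_evalStep hW hm G n))
  have hnorm : ∀ n, (eLpNorm (partialSum W f n - stationarySum W (pathStep G) n) 2 μ).toReal
      = ‖∑ k ∈ Finset.range n, evalState hW hm (k + 1) (hf.toLp f)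
        - ∑ k ∈ Finset.range n, evalStep hW hm k G‖ := fun n => by
    rw [Lp.norm_def, eLpNorm_congr_ae (hae n)]
  have hle : ∀ n : ℕ, 1 ≤ n →
      (eLpNorm (partialSum W f n - stationarySum W (pathStep G) n) 2 μ).toReal ^ 2
        ≤ 928 * (n * tailRate (orbitSq T (hf.toLp f)) n) := fun n hn => by
    rw [hnorm]
    exact norm_sum_evalState_sub_sum_evalStep_sq_le hW hm _ hs hG hn (hrate n hn)
  refine ⟨pathStep G, ⟨memLp_pathStep hW hm G, martingale_stationarySum hW hm hG, ?_⟩,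
    fun n hn => ⟨(Lp.memLp _).ae_eq (hae n), ?_⟩⟩
  · -- The remainder follows from the bound, because the rate tends to `0`.
    refine IsLittleO.of_pow (n := 2) ?_ two_ne_zero
    have h1 : (fun n : ℕ => 928 * tailRate (orbitSq T (hf.toLp f)) n) =o[atTop]
        fun _ : ℕ => (1 : ℝ) := by
      rw [isLittleO_one_iff]
      simpa using (tendsto_tailRate hb hs).const_mul 928
    have h2 := h1.mul_isBigO (isBigO_refl (fun n : ℕ => (n : ℝ)) atTop)
    refine (IsBigO.of_bound 1 ?_).trans_isLittleO (h2.congr_right fun n => ?_)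
    · filter_upwards [eventually_ge_atTop 1] with n hn
      have h3 := hle n hn
      rw [one_mul, Pi.pow_apply, Real.norm_of_nonneg (sq_nonneg _)]
      refine (h3.trans_eq ?_).trans (le_abs_self _)
      ring
    · simp
  · have h1 := tailRate_eq hb hs n
    have hn0 : (0 : ℝ) < n := by positivity
    change _ ≤ 928 * (1 / (n : ℝ) * ∑ k ∈ Finset.Icc 1 n, orbitSq T (hf.toLp f) k / (k : ℝ)
      + ∑' k : ℕ, orbitSq T (hf.toLp f) (n + 1 + k) / ((n + 1 + k : ℕ) : ℝ) ^ 2)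
    rw [← h1, one_div, inv_mul_le_iff₀ hn0]
    refine (hle n hn).trans_eq ?_
    ring
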